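/- Let $G$ be a finite group with identity $e$, and for $g\in G$ let $g^G=\{hgh^{-1} : h\in G\}$ denote its conjugacy class. Let $C_0=\{e\},C_1,\dots,C_d$ be the conjugacy classes of $G$. The group association scheme of $G$ is the association scheme on the set $G$ whose adjacency matrices $A_0,\dots,A_d\in M_{|G|}(\mathbb{C})$ are given by $(A_i)_{xy}=1$ if $yx^{-1}\in C_i$ and $(A_i)_{xy}=0$ otherwise. Put $\mathfrak{A}=\mathrm{Span}_{\mathbb{C}}\{A_0,\dots,A_d\}$. For each $i$ let $E_i^*$ be the diagonal matrix with $(E_i^*)_{yy}=(A_i)_{ey}$, and put $\mathfrak{A}^*=\mathrm{Span}_{\mathbb{C}}\{E_0^*,\dots,E_d^*\}$. The Terwilliger algebra $T(G)$ is the subalgebra of $M_{|G|}(\mathbb{C})$ generated by $\mathfrak{A}$ and $\mathfrak{A}^*$; it acts on $\mathbb{C}^{|G|}$ by left multiplication. The primary module is $\mathfrak{A}\hat{e}\subseteq\mathbb{C}^{|G|}$, where $\hat{e}$ is the vector with $1$ in position $e$ and $0$ elsewhere. The algebra $T(G)$ is called almost commutative if every irreducible $T(G)$-submodule of $\mathbb{C}^{|G|}$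 other than the primary module has dimension $1$ over $\mathbb{C}$. Lemma. Suppose that $T(G)$ is almost commutative. Then for all $x,y\in G$ with $x^G\neq (y^{-1})^G$, we have $x^Gy^G=(xy)^G$, where $x^Gy^G=\{ab : a\in x^G,\ b\in y^G\}$. -/

import Mathlib

open scoped Pointwise

section Terwilliger

open Matrix
open scoped Matrix.Module

/-- An association scheme on the finite set `Ω`, given by its adjacency matrices `A i`;
`zero` is the index of the trivial relation. -/
structure AssociationScheme (Ω ι : Type*) [Fintype Ω] [DecidableEq Ω] [Fintype ι] where
  A : ι → Matrix Ω Ω ℂ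
  zero : ι
  zero_one : ∀ i x y, A i x y = 0 ∨ A i x y = 1
  A_zero : A zero = 1
  transpose_mem : ∀ i, ∃ j, (A i)ᵀ = A j
  mul_mem : ∀ i j, ∃ p : ι → ℂ, A i * A j = ∑ k, p k • A k
  A_ne_zero : ∀ i, A i ≠ 0
  sum_A : ∑ i, A i = Matrix.of fun _ _ => 1

namespace AssociationScheme

variable {Ω ι : Type*} [Fintype Ω] [DecidableEq Ω] [Fintype ι] (S : AssociationScheme Ω ι)

/-- The Bose-Mesner algebra, as the span of the adjacency matrices. -/
def boseMesner : Submodule ℂ (Matrix Ω Ω ℂ) :=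
  Submodule.span ℂ (Set.range S.A)

/-- The diagonal matrix `E_i^*(x)`: the `x`-th row of `A_i` put on the diagonal. -/
def dualIdempotent (x : Ω) (i : ι) : Matrix Ω Ω ℂ :=
  Matrix.diagonal fun y => S.A i x y

/-- The dual Bose-Mesner algebra with base point `x`. -/
def dualBoseMesner (x : Ω) : Submodule ℂ (Matrix Ω Ω ℂ) :=
  Submodule.span ℂ (Set.range (S.dualIdempotent x))

/-- The Terwilliger algebra `T(x)`: the subalgebra of the full matrix algebra generated by the
Bose-Mesner algebra and the dual Bose-Mesner algebra with base point `x`. -/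
def terwilliger (x : Ω) : Subalgebra ℂ (Matrix Ω Ω ℂ) :=
  Algebra.adjoin ℂ ((S.boseMesner : Set (Matrix Ω Ω ℂ)) ∪ S.dualBoseMesner x)

/-- The primary module: all vectors `M x̂` with `M` in the Bose-Mesner algebra, where `x̂` is the
standard basis vector at `x`. -/
def primaryModule (x : Ω) : Submodule ℂ (Ω → ℂ) :=
  S.boseMesner.map ((Matrix.mulVecBilin ℂ ℂ).flip (Pi.single x 1))

/-- `T(x)` is almost commutative: every irreducible `T(x)`-submodule of the standard module
`ℂ^Ω` (on which `T(x)` acts by left multiplication) other than the primary module is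
one-dimensional over `ℂ`. -/
def IsAlmostCommutative (x : Ω) : Prop :=
  ∀ W : Submodule (S.terwilliger x) (Ω → ℂ), IsSimpleModule (S.terwilliger x) W →
    W.restrictScalars ℂ ≠ S.primaryModule x →
    Module.finrank ℂ (W.restrictScalars ℂ) = 1

end AssociationScheme

open Classical in
/-- The adjacency matrix of the conjugacy class `C`: its `(x, y)` entry is `1` if `y * x⁻¹ ∈ C`
and `0` otherwise. -/
noncomputable def conjAdj {G : Type*} [Group G] (C : ConjClasses G) : Matrix G G ℂ :=
  Matrix.of fun x y => if y * x⁻¹ ∈ C.carrier then 1 else 0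

theorem conjAdj_apply {G : Type*} [Group G] [Fintype G] [DecidableEq G] (C : ConjClasses G)
    (x y : G) : conjAdj C x y = if ConjClasses.mk (y * x⁻¹) = C then 1 else 0 := by
  simp only [conjAdj, Matrix.of_apply, ConjClasses.mem_carrier_iff_mk_eq]

theorem conjAdj_mul_apply {G : Type*} [Group G] [Fintype G] [DecidableEq G]
    (C D : ConjClasses G) (x y c : G) :
    (conjAdj C * conjAdj D) x y = (conjAdj C * conjAdj D) 1 (c * (y * x⁻¹) * c⁻¹) := by
  rw [Matrix.mul_apply, Matrix.mul_apply]
  refine Fintype.sum_equiv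
    ((Equiv.mulRight x⁻¹).trans ((Equiv.mulLeft c).trans (Equiv.mulRight c⁻¹))) _ _ fun z => ?_
  have h1 : (ConjClasses.mk (c * (z * x⁻¹) * c⁻¹ * 1⁻¹) : ConjClasses G)
      = ConjClasses.mk (z * x⁻¹) := by
    rw [ConjClasses.mk_eq_mk_iff_isConj, isConj_comm, isConj_iff]
    exact ⟨c, by group⟩
  have h2 : (ConjClasses.mk (c * (y * x⁻¹) * c⁻¹ * (c * (z * x⁻¹) * c⁻¹)⁻¹) : ConjClasses G)
      = ConjClasses.mk (y * z⁻¹) := by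
    rw [ConjClasses.mk_eq_mk_iff_isConj, isConj_comm, isConj_iff]
    exact ⟨c, by group⟩
  simp only [conjAdj_apply, Equiv.trans_apply, Equiv.coe_mulRight, Equiv.coe_mulLeft,
    h1, h2]

/-- The group association scheme of a finite group `G`, whose relations are indexed by the
conjugacy classes of `G`. -/
noncomputable def groupScheme (G : Type*) [Group G] [Fintype G] [DecidableEq G] :
    AssociationScheme G (ConjClasses G) where
  A := conjAdj
  zero := ConjClasses.mk 1
  zero_one C x y := by
    rw [conjAdj_apply]
    split_ifs <;> simp
  A_zero := by
    ext x y
    rw [conjAdj_apply, Matrix.one_apply]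
    refine if_congr ?_ rfl rfl
    rw [ConjClasses.mk_eq_mk_iff_isConj, isConj_comm, isConj_one_right, mul_inv_eq_one, eq_comm]
  transpose_mem C := by
    obtain ⟨a, rfl⟩ := ConjClasses.mk_surjective C
    refine ⟨ConjClasses.mk a⁻¹, ?_⟩
    ext x y
    rw [Matrix.transpose_apply, conjAdj_apply, conjAdj_apply]
    have : (ConjClasses.mk (x * y⁻¹) = ConjClasses.mk a) ↔
        (ConjClasses.mk (y * x⁻¹) = ConjClasses.mk a⁻¹) := by
      rw [ConjClasses.mk_eq_mk_iff_isConj, ConjClasses.mk_eq_mk_iff_isConj, isConj_iff,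
        isConj_iff]
      refine exists_congr fun c => ?_
      rw [← inv_inj (b := a)]
      simp [mul_assoc]
    exact if_congr this rfl rfl
  mul_mem C D := by
    refine ⟨fun K => (conjAdj C * conjAdj D) 1 K.out, ?_⟩
    ext x y
    rw [Matrix.sum_apply, Finset.sum_eq_single (ConjClasses.mk (y * x⁻¹))]
    · have h : IsConj (y * x⁻¹) (ConjClasses.mk (y * x⁻¹)).out := by
        rw [← ConjClasses.mk_eq_mk_iff_isConj]
        exact (Quotient.out_eq _).symm
      obtain ⟨c, hc⟩ := isConj_iff.1 h
      rw [Matrix.smul_apply, conjAdj_apply (ConjClasses.mk _), if_pos rfl, smul_eq_mul, mul_one,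
        conjAdj_mul_apply C D x y c, hc]
    · intro K _ hK
      rw [Matrix.smul_apply, conjAdj_apply K, if_neg (Ne.symm hK), smul_zero]
    · simp
  A_ne_zero C := by
    obtain ⟨a, rfl⟩ := ConjClasses.mk_surjective C
    intro h
    have := congrFun (congrFun h 1) a
    change conjAdj (ConjClasses.mk a) 1 a = 0 at this
    rw [conjAdj_apply] at this
    simp at this
  sum_A := by
    ext x y
    simp [Matrix.sum_apply, conjAdj_apply]

end Terwilliger

/-!
Let `A` be an adjacency matrix of the group scheme and `E` a dual idempotent. The Terwilliger
algebra `T` is closed under the conjugate transpose, so `ℂ^G` is a semisimple `T`-module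
(`isSemisimpleModule_terwilliger`). The vectors `v` for which `t v` vanishes at the identity for
every `t ∈ T` form a `T`-submodule that does not contain the primary module; under almost
commutativity it is therefore a sum of one-dimensional submodules, and elements of `T` commute on
it (`mulVec_comm_of_mem_primaryComplement`).

Entries of elements of `T` are invariant under simultaneous conjugation of both indices, so this
submodule contains `δ_a - δ_b` whenever `a` and `b` are conjugate. Take `E` to be the projection
onto the class of `a`, which fixes `δ_a - δ_b`. Then `A (δ_a - δ_b) = E A (δ_a - δ_b)` is supported
on that class. Reading off the entry at an `h` outside the class, for every `A`, shows that
`a h⁻¹` and `b h⁻¹` are conjugate (`isConj_mul_right_of_isAlmostCommutative`). Hence `x^G y^G` lies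
in a single conjugacy class unless `x` is conjugate to `y⁻¹`.
-/

section AlmostCommutative

open Matrix
open scoped Matrix.Module ComplexOrder

namespace AssociationScheme

variable {Ω ι : Type*} [Fintype Ω] [DecidableEq Ω] [Fintype ι] (S : AssociationScheme Ω ι)

theorem A_mem_terwilliger (x : Ω) (i : ι) : S.A i ∈ S.terwilliger x :=
  Algebra.subset_adjoin (Or.inl (Submodule.subset_span ⟨i, rfl⟩))

theorem dualIdempotent_mem_terwilliger (x : Ω) (i : ι) :
    S.dualIdempotent x i ∈ S.terwilliger x :=
  Algebra.subset_adjoin (Or.inr (Submodule.subset_span ⟨i, rfl⟩))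

/-- Induction for the Terwilliger algebra with the adjacency matrices and the dual idempotents,
rather than their spans, as generators. -/
theorem terwilliger_le {x : Ω} {B : Subalgebra ℂ (Matrix Ω Ω ℂ)} (hA : ∀ i, S.A i ∈ B)
    (hE : ∀ i, S.dualIdempotent x i ∈ B) : S.terwilliger x ≤ B := by
  have h1 : S.boseMesner ≤ Subalgebra.toSubmodule B :=
    Submodule.span_le.2 (Set.range_subset_iff.2 hA)
  have h2 : S.dualBoseMesner x ≤ Subalgebra.toSubmodule B :=
    Submodule.span_le.2 (Set.range_subset_iff.2 hE)
  exact Algebra.adjoin_le (Set.union_subset h1 h2)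

theorem star_A_apply (i : ι) (x y : Ω) : star (S.A i x y) = S.A i x y := by
  rcases S.zero_one i x y with h | h <;> simp [h]

theorem conjTranspose_mem_terwilliger {x : Ω} {M : Matrix Ω Ω ℂ} (hM : M ∈ S.terwilliger x) :
    Mᴴ ∈ S.terwilliger x := by
  refine S.terwilliger_le (B := star (S.terwilliger x)) (fun i => ?_) (fun i => ?_) hM
  · obtain ⟨j, hj⟩ := S.transpose_mem i
    have h : star (S.A i) = S.A j := by
      rw [← hj]
      ext a b
      exact S.star_A_apply i b a
    rw [Subalgebra.mem_star_iff, h]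
    exact S.A_mem_terwilliger x j
  · have h : star (S.dualIdempotent x i) = S.dualIdempotent x i := by
      rw [star_eq_conjTranspose, dualIdempotent, diagonal_conjTranspose]
      congr 1
      ext y
      exact S.star_A_apply i x y
    rw [Subalgebra.mem_star_iff, h]
    exact S.dualIdempotent_mem_terwilliger x i

theorem terwilliger_smul_def {x : Ω} (t : S.terwilliger x) (v : Ω → ℂ) :
    t • v = (t : Matrix Ω Ω ℂ) *ᵥ v := rfl

/-- The orthogonal complement of a `T(x)`-submodule for the standard Hermitian form; it is a
`T(x)`-submodule because `T(x)` is closed under the conjugate transpose. -/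
def orthogonalComplement {x : Ω} (W : Submodule (S.terwilliger x) (Ω → ℂ)) :
    Submodule (S.terwilliger x) (Ω → ℂ) where
  carrier := {v | ∀ w ∈ W, star w ⬝ᵥ v = 0}
  zero_mem' := by simp
  add_mem' := by
    intro u v hu hv w hw
    rw [dotProduct_add, hu w hw, hv w hw, add_zero]
  smul_mem' := by
    intro t v hv w hw
    have := hv _ (W.smul_mem ⟨_, S.conjTranspose_mem_terwilliger t.2⟩ hw)
    rwa [terwilliger_smul_def, star_mulVec, conjTranspose_conjTranspose,
      ← dotProduct_mulVec] at this

theorem isCompl_orthogonalComplement {x : Ω} (W : Submodule (S.terwilliger x) (Ω → ℂ)) :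
    IsCompl W (S.orthogonalComplement W) := by
  constructor
  · rw [Submodule.disjoint_def]
    intro v hv hv'
    exact dotProduct_star_self_eq_zero.1 (hv' v hv)
  · rw [codisjoint_iff, eq_top_iff]
    rintro v -
    let K : Submodule ℂ (EuclideanSpace ℂ Ω) :=
      (W.restrictScalars ℂ).comap (WithLp.linearEquiv 2 ℂ (Ω → ℂ)).toLinearMap
    obtain ⟨y, hy, z, hz, hyz⟩ := K.exists_add_mem_mem_orthogonal (WithLp.toLp 2 v)
    have hv : v = y.ofLp + z.ofLp := by
      rw [← WithLp.ofLp_add, ← hyz]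
    rw [hv]
    refine Submodule.add_mem_sup hy fun w hw => ?_
    have := (Submodule.mem_orthogonal _ _).1 hz (WithLp.toLp 2 w) hw
    rw [EuclideanSpace.inner_eq_star_dotProduct] at this
    rw [dotProduct_comm]
    exact this

theorem isSemisimpleModule_terwilliger (x : Ω) :
    IsSemisimpleModule (S.terwilliger x) (Ω → ℂ) :=
  { exists_isCompl := fun W => ⟨_, S.isCompl_orthogonalComplement W⟩ }

/-- The orthogonal complement of the primary module, described as the largest `T(x)`-submodule
of vectors vanishing at the base point `x`. -/
def primaryComplement (x : Ω) : Submodule (S.terwilliger x) (Ω → ℂ) where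
  carrier := {v | ∀ t ∈ S.terwilliger x, (t *ᵥ v) x = 0}
  zero_mem' := by simp
  add_mem' := by
    intro u v hu hv t ht
    rw [mulVec_add, Pi.add_apply, hu t ht, hv t ht, add_zero]
  smul_mem' := by
    intro s v hv t ht
    rw [terwilliger_smul_def, mulVec_mulVec]
    exact hv _ (Subalgebra.mul_mem _ ht s.2)

theorem single_mem_primaryModule (x : Ω) :
    (Pi.single x 1 : Ω → ℂ) ∈ S.primaryModule x :=
  ⟨1, S.A_zero ▸ Submodule.subset_span ⟨S.zero, rfl⟩, by simp⟩

/-- A simple submodule of the complement is not the primary module, hence is a line, on which any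
two operators commute. -/
theorem mulVec_comm_of_mem_primaryComplement {x : Ω} (hS : S.IsAlmostCommutative x)
    {s t : Matrix Ω Ω ℂ} (hs : s ∈ S.terwilliger x) (ht : t ∈ S.terwilliger x) {v : Ω → ℂ}
    (hv : v ∈ S.primaryComplement x) : s *ᵥ (t *ᵥ v) = t *ᵥ (s *ᵥ v) := by
  have := S.isSemisimpleModule_terwilliger x
  rw [← IsSemisimpleModule.sSup_simples_le (S.primaryComplement x), sSup_eq_iSup'] at hv
  induction hv using Submodule.iSup_induction' with
  | zero => simp
  | add u v _ _ hu hv => simp only [mulVec_add, hu, hv]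
  | mem W w hw =>
    obtain ⟨W, hW, hWN⟩ := W
    have hne : W.restrictScalars ℂ ≠ S.primaryModule x := by
      intro h
      have h1 : (Pi.single x 1 : Ω → ℂ) ∈ W.restrictScalars ℂ :=
        h ▸ S.single_mem_primaryModule x
      have h2 := hWN h1 1 (one_mem _)
      simp at h2
    obtain ⟨u, -, hu⟩ := finrank_eq_one_iff'.1 (hS W hW hne)
    have key : ∀ z ∈ W, ∃ c : ℂ, c • (u : Ω → ℂ) = z := fun z hz =>
      (hu ⟨z, hz⟩).imp fun c hc => congrArg Subtype.val hc
    obtain ⟨a, ha⟩ := key _ (W.smul_mem ⟨s, hs⟩ u.2)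
    obtain ⟨b, hb⟩ := key _ (W.smul_mem ⟨t, ht⟩ u.2)
    rw [terwilliger_smul_def] at ha hb
    obtain ⟨c, rfl⟩ := key w hw
    simp only [mulVec_smul, ← ha, ← hb]
    rw [smul_comm a b]

end AssociationScheme

theorem ConjClasses.mk_conj {G : Type*} [Group G] (c g : G) :
    ConjClasses.mk (c * g * c⁻¹) = ConjClasses.mk g :=
  (ConjClasses.mk_eq_mk_iff_isConj.2 (isConj_iff.2 ⟨c, rfl⟩)).symm

variable {G : Type*} [Group G] [Fintype G] [DecidableEq G]

theorem groupScheme_A_apply (C : ConjClasses G) (x y : G) :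
    (groupScheme G).A C x y = if ConjClasses.mk (y * x⁻¹) = C then 1 else 0 :=
  conjAdj_apply C x y

theorem groupScheme_A_conj (C : ConjClasses G) (c a b : G) :
    (groupScheme G).A C (c * a * c⁻¹) (c * b * c⁻¹) = (groupScheme G).A C a b := by
  have : c * b * c⁻¹ * (c * a * c⁻¹)⁻¹ = c * (b * a⁻¹) * c⁻¹ := by group
  rw [groupScheme_A_apply, groupScheme_A_apply, this, ConjClasses.mk_conj]

/-- The Terwilliger algebra of a group scheme centralizes the conjugation action of the group. -/
theorem apply_conj_of_mem_terwilliger {t : Matrix G G ℂ} (ht : t ∈ (groupScheme G).terwilliger 1)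
    (c a b : G) : t (c * a * c⁻¹) (c * b * c⁻¹) = t a b := by
  let B : Subalgebra ℂ (Matrix G G ℂ) :=
    { carrier := {M | ∀ a b, M (c * a * c⁻¹) (c * b * c⁻¹) = M a b}
      add_mem' := fun hM hN a b => by rw [Matrix.add_apply, Matrix.add_apply, hM, hN]
      mul_mem' := fun {M N} hM hN a b => by
        rw [mul_apply, mul_apply]
        refine (Fintype.sum_equiv (MulAut.conj c).toEquiv _ _ fun z => ?_).symm
        exact (congrArg₂ _ (hM a z) (hN z b)).symm
      algebraMap_mem' := fun r a b => by
        simp [algebraMap_matrix_apply] }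
  refine (groupScheme G).terwilliger_le (B := B) (fun C a b => groupScheme_A_conj C c a b)
    (fun C a b => ?_) ht a b
  have := groupScheme_A_conj C c 1 a
  rw [mul_one, mul_inv_cancel] at this
  simp only [AssociationScheme.dualIdempotent, diagonal_apply, this, mul_left_inj, mul_right_inj]

theorem single_sub_single_mem_primaryComplement {a b : G} (hab : IsConj a b) :
    (Pi.single a 1 - Pi.single b 1 : G → ℂ) ∈ (groupScheme G).primaryComplement 1 := by
  intro t ht
  obtain ⟨c, rfl⟩ := isConj_iff.1 hab
  have := apply_conj_of_mem_terwilliger ht c 1 a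
  rw [mul_one, mul_inv_cancel] at this
  simp [mulVec_sub, this]

theorem isConj_mul_right_of_isAlmostCommutative (hG : (groupScheme G).IsAlmostCommutative 1)
    {a b k : G} (hab : IsConj a b) (hk : ¬ IsConj k⁻¹ a) : IsConj (a * k) (b * k) := by
  -- The matrix of the class of `a * k` has entry `1` at `(k⁻¹, a)`.
  let C := ConjClasses.mk (a * k)
  have h := (groupScheme G).mulVec_comm_of_mem_primaryComplement hG
    ((groupScheme G).dualIdempotent_mem_terwilliger 1 (ConjClasses.mk a))
    ((groupScheme G).A_mem_terwilliger 1 C) (single_sub_single_mem_primaryComplement hab)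
  have hfix : (groupScheme G).dualIdempotent 1 (ConjClasses.mk a) *ᵥ
      (Pi.single a 1 - Pi.single b 1 : G → ℂ) = Pi.single a 1 - Pi.single b 1 := by
    have hb : ConjClasses.mk b = ConjClasses.mk a :=
      (ConjClasses.mk_eq_mk_iff_isConj.2 hab).symm
    simp [AssociationScheme.dualIdempotent, mulVec_sub, groupScheme_A_apply, hb]
  rw [hfix] at h
  have h' := congrFun h k⁻¹
  have hk' : ConjClasses.mk k⁻¹ ≠ ConjClasses.mk a := fun h =>
    hk (ConjClasses.mk_eq_mk_iff_isConj.1 h)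
  rw [AssociationScheme.dualIdempotent, mulVec_diagonal, groupScheme_A_apply, inv_one, mul_one,
    if_neg hk', zero_mul, mulVec_sub, mulVec_single_one, mulVec_single_one, Pi.sub_apply,
    col_apply, col_apply, groupScheme_A_apply, groupScheme_A_apply, inv_inv, if_pos rfl] at h'
  by_contra hne
  rw [if_neg fun h => hne (ConjClasses.mk_eq_mk_iff_isConj.1 h).symm] at h'
  simp at h'

end AlmostCommutative

theorem mainTheorem3 (G : Type*) [Group G] [Fintype G] [DecidableEq G]
    (hG : (groupScheme G).IsAlmostCommutative 1) (x y : G)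
    (hxy : conjugatesOf x ≠ conjugatesOf y⁻¹) :
    conjugatesOf x * conjugatesOf y = conjugatesOf (x * y) := by
  have hne : ¬ IsConj y⁻¹ x := fun h => hxy (isConj_iff_conjugatesOf_eq.1 h.symm)
  ext z
  rw [Set.mem_mul]
  constructor
  · rintro ⟨a, ha, b, hb, rfl⟩
    simp only [conjugatesOf, Set.mem_ofPred_eq] at ha hb ⊢
    have hba : ¬ IsConj b⁻¹ x := by
      obtain ⟨c, rfl⟩ := isConj_iff.1 hb
      exact fun h => hne ((isConj_iff.2 ⟨c, by group⟩ : IsConj y⁻¹ (c * y * c⁻¹)⁻¹).trans h)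
    have hxy' : ¬ IsConj x⁻¹ y := fun h => hne <| by
      obtain ⟨c, rfl⟩ := isConj_iff.1 h
      exact isConj_iff.2 ⟨c⁻¹, by group⟩
    have swap (g h : G) : IsConj (g * h) (h * g) := isConj_iff.2 ⟨h, by group⟩
    -- The chain `x y ~ y x ~ b x ~ x b ~ a b`.
    exact (swap x y).trans <| (isConj_mul_right_of_isAlmostCommutative hG hb hxy').trans <|
      (swap b x).trans <| isConj_mul_right_of_isAlmostCommutative hG ha hba
  · intro hz
    obtain ⟨c, rfl⟩ := isConj_iff.1 (show IsConj (x * y) z from hz)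
    exact ⟨c * x * c⁻¹, isConj_iff.2 ⟨c, rfl⟩, c * y * c⁻¹,
      isConj_iff.2 ⟨c, rfl⟩, by group⟩
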